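/- Let $N\in\mathbb N$ and for $j=1,\dots,N$ let $(A_j,\varphi_j)$ be a noncommutative probability space, i.e. a unital complex algebra $A_j$ with a linear functional $\varphi_j:A_j\to\mathbb C$, $\varphi_j(1)=1$. Let $A=A_1\times\dots\times A_N$ be the direct product algebra with componentwise operations, let $D_N=\mathbb C^N$ with componentwise operations, regarded as a (central) subalgebra of $A$ via $(\alpha_j)_j\mapsto(\alpha_j 1_{A_j})_j$, and let $E=(\varphi_1,\dots,\varphi_N):A\to D_N$. For $x_1,\dots,x_n\in A$ the $D_N$-valued cumulant is $$k_n(x_1,\dots,x_n)=\sum_{\pi\in NC(n)}\mu(\pi,1_n)\prod_{V\in\pi}E\Big(\prod_{i\in V}^{\rightarrow}x_i\Big),$$ where $NC(n)$ is the lattice of noncrossing partitions of $\{1,\dots,n\}$ ordered by refinement, $1_n$ is its maximal element, $\mu$ is its Möbius function, and $\prod^{\rightarrow}$ is the product in increasing order of indices. Elements $x,y\in A$ are free over $D_N$ if all mixed cumulants of the subalgebras $A_x=\mathrm{Alg}\{x,D_N\}$ and $A_y=\mathrm{Alg}\{y,D_N\}$ vanish: $k_n(a_1,\dots,a_n)=0$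 whenever every $a_i$ is taken from $A_x$ or from $A_y$ and both subalgebras are used. Put $D_N^{-1}=\{d\in D_N: d_j\neq0\text{ for all }j\}$ and let $D_N^{inv}[[z]]$ be the set of power series over $D_N$ with constant term in $D_N^{-1}$. Let $R_x(z)=\sum_{n\ge1}k_n(x,\dots,x)z^n\in D_N[[z]]$. If $E(x)\in D_N^{-1}$, then $R_x$ has an inverse $R_x^{\langle-1\rangle}(z)$ with respect to composition, without constant term, and one defines $S_x(z)=\frac1z R_x^{\langle-1\rangle}(z)\in D_N[[z]]$. Suppose $x,y\in A$ satisfy $E(x),E(y)\in D_N^{-1}$ and are free over $D_N$. Then $E(xy)\in D_N^{-1}$, the series $S_x$, $S_y$, $S_{xy}$ lie in $D_N^{inv}[[z]]$, and $$S_{xy}(z)=S_x(z)\,S_y(z).$$ -/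

import Mathlib

namespace DirectProductFreeProb

/-! ### Noncrossing partitions -/

/-- A partition of `{0, …, n-1}` is noncrossing if there are no `i < j < k < l` with `i, k` in one
block and `j, l` in another block. -/
def IsNoncrossing {n : ℕ} (π : Finpartition (Finset.univ : Finset (Fin n))) : Prop :=
  ∀ V ∈ π.parts, ∀ W ∈ π.parts, ∀ i j k l : Fin n, i < j → j < k → k < l →
    i ∈ V → k ∈ V → j ∈ W → l ∈ W → V = W

/-- `NC(n)`, ordered by refinement. -/
abbrev NC (n : ℕ) : Type :=
  {π : Finpartition (Finset.univ : Finset (Fin n)) // IsNoncrossing π}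

noncomputable instance instFintypeNC (n : ℕ) : Fintype (NC n) := by
  classical exact Subtype.fintype _

noncomputable instance instLocallyFiniteOrderNC (n : ℕ) : LocallyFiniteOrder (NC n) := by
  classical exact Fintype.toLocallyFiniteOrder

theorem isNoncrossing_top (n : ℕ) :
    IsNoncrossing (⊤ : Finpartition (Finset.univ : Finset (Fin n))) := by
  intro V hV W hW i j k l _ _ _ _ _ _ _
  have h1 := Finset.mem_singleton.1 (Finpartition.parts_top_subset _ hV)
  have h2 := Finset.mem_singleton.1 (Finpartition.parts_top_subset _ hW)
  rw [h1, h2]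

/-- The maximal partition `1_n` (one single block if `n ≥ 1`). -/
def NC.one (n : ℕ) : NC n := ⟨⊤, isNoncrossing_top n⟩

open Classical in
/-- The Möbius function of the lattice `NC(n)`: the inverse of the zeta function in its incidence
algebra. -/
noncomputable def NC.moebius {n : ℕ} (π σ : NC n) : ℂ := IncidenceAlgebra.mu ℂ π σ

/-! ### The direct product space and its cumulants -/

/-- The diagonal algebra `D_N`, that is `ℂ^N` with componentwise operations. -/
abbrev Diag (N : ℕ) : Type := Fin N → ℂ

/-- The set `D_N^{-1}` of elements of `D_N` with no zero entry, i.e. of invertible elements. -/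
def Diag.inv (N : ℕ) : Set (Diag N) := {d | ∀ j, d j ≠ 0}

/-- The set `D_N^{inv}[[z]]` of power series over `D_N` with constant term in `D_N^{-1}`. -/
def invSeries (N : ℕ) : Set (PowerSeries (Diag N)) :=
  {f | PowerSeries.constantCoeff f ∈ Diag.inv N}

variable {N : ℕ} {A : Fin N → Type*} [∀ j, Ring (A j)] [∀ j, Algebra ℂ (A j)]

/-- The copy of `D_N` inside the direct product algebra. -/
def diagSet (A : Fin N → Type*) [∀ j, Ring (A j)] [∀ j, Algebra ℂ (A j)] : Set (∀ j, A j) :=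
  Set.range fun (d : Diag N) (j : Fin N) => algebraMap ℂ (A j) (d j)

/-- The map `E = (φ_1, …, φ_N)` from the direct product onto `D_N`. -/
def condExp (φ : ∀ j, A j →ₗ[ℂ] ℂ) : (∀ j, A j) →ₗ[ℂ] Diag N :=
  LinearMap.pi fun j => (φ j).comp (LinearMap.proj j)

/-- The ordered product `x_{i_1} ⋯ x_{i_k}` over a block `V = {i_1 < ⋯ < i_k}`. -/
def blockProd {n : ℕ} (x : Fin n → ∀ j, A j) (V : Finset (Fin n)) : ∀ j, A j :=
  ((V.sort (· ≤ ·)).map x).prod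

/-- The partition-dependent moment `E_π(x_1, …, x_n)`. Since `D_N` is commutative and central in the
direct product, the nested evaluation of `E` along `π` is the product over the blocks of `π`. -/
def partMoment (φ : ∀ j, A j →ₗ[ℂ] ℂ) {n : ℕ} (π : NC n) (x : Fin n → ∀ j, A j) : Diag N :=
  ∏ V ∈ π.1.parts, condExp φ (blockProd x V)

/-- The `D_N`-valued cumulant `k_n(x_1, …, x_n) = ∑_{π ∈ NC(n)} E_π(x_1, …, x_n) μ(π, 1_n)`. -/
noncomputable def cumulant (φ : ∀ j, A j →ₗ[ℂ] ℂ) {n : ℕ} (x : Fin n → ∀ j, A j) : Diag N :=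
  ∑ π : NC n, NC.moebius π (NC.one n) • partMoment φ π x

/-! ### Freeness over `D_N` -/

/-- Subalgebras `A₁`, `A₂` are free over `D_N` if all their mixed cumulants vanish. The map `c`
records from which of the two subalgebras each argument is taken. -/
def FreeSubalgebras (φ : ∀ j, A j →ₗ[ℂ] ℂ) (A₁ A₂ : Subalgebra ℂ (∀ j, A j)) : Prop :=
  ∀ (n : ℕ) (c : Fin n → Bool) (a : Fin n → ∀ j, A j),
    (∀ i, c i = true → a i ∈ A₁) → (∀ i, c i = false → a i ∈ A₂) →
    (∃ i i', c i ≠ c i') → cumulant φ a = 0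

/-- `x` and `y` are free over `D_N` if the subalgebras `Alg{x, D_N}` and `Alg{y, D_N}` are. -/
def FreeOverDiag (φ : ∀ j, A j →ₗ[ℂ] ℂ) (x y : ∀ j, A j) : Prop :=
  FreeSubalgebras φ (Algebra.adjoin ℂ ({x} ∪ diagSet A)) (Algebra.adjoin ℂ ({y} ∪ diagSet A))

/-! ### The R-transform and the S-transform -/

/-- `R_x(z) = ∑_{n ≥ 1} k_n(x, …, x) z^n` in `D_N[[z]]`. -/
noncomputable def rTransform (φ : ∀ j, A j →ₗ[ℂ] ℂ) (x : ∀ j, A j) : PowerSeries (Diag N) :=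
  PowerSeries.mk fun n => if n = 0 then 0 else cumulant φ fun _ : Fin n => x

theorem cumulant_one (φ : ∀ j, A j →ₗ[ℂ] ℂ) (x : ∀ j, A j) :
    cumulant φ (fun _ : Fin 1 => x) = condExp φ x := by
  have hbot : (Finset.univ : Finset (Fin 1)) ≠ ⊥ := by simp
  have huniq : ∀ P : Finpartition (Finset.univ : Finset (Fin 1)), P = ⊤ := by
    intro P
    have hat : IsAtom (Finset.univ : Finset (Fin 1)) := by
      rw [Finset.isAtom_iff]; exact ⟨0, rfl⟩
    let := hat.uniqueFinpartition (P := P)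
    exact Subsingleton.elim _ _
  have htop : (⊤ : Finpartition (Finset.univ : Finset (Fin 1))).parts = {Finset.univ} := by
    rw [huniq ⊤, ← huniq (Finpartition.indiscrete hbot)]; rfl
  have hone : ∀ π : NC 1, π = NC.one 1 := fun π => Subtype.ext (huniq π.1)
  unfold cumulant
  rw [Fintype.sum_eq_single (NC.one 1) (fun π h => absurd (hone π) h)]
  simp [NC.moebius, partMoment, NC.one, htop, blockProd]

theorem isUnit_coeff_one_rTransform (φ : ∀ j, A j →ₗ[ℂ] ℂ) (x : ∀ j, A j)
    (hx : condExp φ x ∈ Diag.inv N) : IsUnit (PowerSeries.coeff 1 (rTransform φ x)) := by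
  have h : PowerSeries.coeff 1 (rTransform φ x) = condExp φ x := by
    simp [rTransform, cumulant_one]
  rw [h, Pi.isUnit_iff]
  exact fun j => (hx j).isUnit

/-- The inverse `R_x^{<-1>}(z)` of `R_x(z)` with respect to composition. -/
noncomputable def rTransformInv (φ : ∀ j, A j →ₗ[ℂ] ℂ) (x : ∀ j, A j)
    (hx : condExp φ x ∈ Diag.inv N) : PowerSeries (Diag N) :=
  (rTransform φ x).substInvOfIsUnit (isUnit_coeff_one_rTransform φ x hx)

/-- `S_x(z) = (1/z) R_x^{<-1>}(z)`. The series `R_x^{<-1>}` has no constant term, so division by `z`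
shifts its coefficients. -/
noncomputable def sTransform (φ : ∀ j, A j →ₗ[ℂ] ℂ) (x : ∀ j, A j)
    (hx : condExp φ x ∈ Diag.inv N) : PowerSeries (Diag N) :=
  PowerSeries.mk fun n => PowerSeries.coeff (n + 1) (rTransformInv φ x hx)

/-- The defining property of the S-transform: `z S_x(z)` is the compositional inverse of `R_x(z)`. -/
theorem X_mul_sTransform (φ : ∀ j, A j →ₗ[ℂ] ℂ) (x : ∀ j, A j)
    (hx : condExp φ x ∈ Diag.inv N) :
    (rTransform φ x).subst (PowerSeries.X * sTransform φ x hx) = PowerSeries.X ∧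
      (PowerSeries.X * sTransform φ x hx).subst (rTransform φ x) = PowerSeries.X := by
  have h0 : PowerSeries.constantCoeff (rTransform φ x) = 0 := by simp [rTransform]
  have h : PowerSeries.X * sTransform φ x hx = rTransformInv φ x hx := by
    ext n : 1
    cases n with
    | zero => simp [rTransformInv]
    | succ n => simp [sTransform, PowerSeries.coeff_succ_X_mul]
  rw [h]
  exact ⟨PowerSeries.subst_substInvOfIsUnit_right _ h0 _,
    PowerSeries.subst_substInvOfIsUnit_left _ h0 _⟩

end DirectProductFreeProb

/-! Write M_x(z) = ∑ E(x^n) z^n. The moment-cumulant formula gives M_x(z) = 1 + R_x(z M_x(z))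
(`mk_moment_eq_subst`). Hence if M_x(z s(z)) = 1 + z, then R_x(z s (1 + z)) = z, that is S_x = s (1
+ z) (`sTransform_eq`). With t the analogous series for y, the theorem amounts to M_{xy}(z s t (1 +
z)) = 1 + z.

This is proved with resolvents over power series. Both a = (1 - z s x)⁻¹ and b = (1 - z t y)⁻¹ have
expectation 1 + z, so a = 1 + z + zα and b = 1 + z + zβ with α, β centred. A direct computation
gives a (1 - z s t (1 + z) xy) b = (1 + z) (1 - z d αβ) with d = (1 + z)⁻¹, so the resolvent of xy
is d b (1 - z d αβ)⁻¹ a (`resolvent_mul_eq_one`). In its geometric expansion every alternating word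
in α, β of positive length has expectation 0, and d (1 + z)² = 1 + z remains.

Freeness enters only through the vanishing of alternating centred moments
(`FreeSubalgebras.condExp_prod_eq_zero`): in an alternating word every noncrossing partition has a
singleton block, contributing a centred first moment, or a block mixing the two subalgebras.
Partitions of arbitrary finite sets, not just of `Fin n`, are used so that blocks can be treated
recursively. -/

namespace DirectProductFreeProb

open Finset

/-! ### Noncrossing partitions of finite subsets of a linear order -/

section Combinatorics

variable {ι ι' B : Type*} [LinearOrder ι] [LinearOrder ι'] [CommRing B]

/-- `P` is a noncrossing partition of the finite set `S`. -/
structure IsNCPartition (P : Finset (Finset ι)) (S : Finset ι) : Prop where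
  nonempty : ∀ V ∈ P, V.Nonempty
  eq_of_mem : ∀ V ∈ P, ∀ W ∈ P, ∀ i, i ∈ V → i ∈ W → V = W
  mem_iff : ∀ i, i ∈ S ↔ ∃ V ∈ P, i ∈ V
  noncrossing : ∀ V ∈ P, ∀ W ∈ P, ∀ i j k l, i < j → j < k → k < l →
    i ∈ V → k ∈ V → j ∈ W → l ∈ W → V = W

theorem IsNCPartition.subset {P : Finset (Finset ι)} {S V : Finset ι} (h : IsNCPartition P S)
    (hV : V ∈ P) : V ⊆ S := fun i hi => (h.mem_iff i).2 ⟨V, hV, hi⟩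

open Classical in
/-- The finite set of noncrossing partitions of `S`. -/
noncomputable def ncParts (S : Finset ι) : Finset (Finset (Finset ι)) :=
  S.powerset.powerset.filter fun P => IsNCPartition P S

theorem mem_ncParts {P : Finset (Finset ι)} {S : Finset ι} :
    P ∈ ncParts S ↔ IsNCPartition P S := by
  simp only [ncParts, mem_filter, mem_powerset, and_iff_right_iff_imp]
  exact fun h V hV => mem_powerset.2 (h.subset hV)

/-- The sum over the noncrossing partitions of `S` of the products of the weights of the blocks. -/
noncomputable def ncSum (w : Finset ι → B) (S : Finset ι) : B :=
  ∑ P ∈ ncParts S, ∏ V ∈ P, w V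

theorem ncParts_empty : ncParts (∅ : Finset ι) = {∅} := by
  ext P
  rw [mem_ncParts, mem_singleton]
  constructor
  · intro h
    refine eq_empty_of_forall_notMem fun V hV => ?_
    obtain ⟨i, hi⟩ := h.nonempty V hV
    exact notMem_empty i (h.subset hV hi)
  · rintro rfl
    constructor <;> simp

@[simp] theorem ncSum_empty (w : Finset ι → B) : ncSum w ∅ = 1 := by
  simp [ncSum, ncParts_empty]

theorem isNCPartition_singleton {S : Finset ι} (hS : S.Nonempty) : IsNCPartition {S} S := by
  constructor <;> simp_all

theorem ncSum_congr {w w' : Finset ι → B} {S : Finset ι}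
    (h : ∀ V ⊆ S, V.Nonempty → w V = w' V) : ncSum w S = ncSum w' S :=
  sum_congr rfl fun _ hP => prod_congr rfl fun V hV =>
    h V ((mem_ncParts.1 hP).subset hV) ((mem_ncParts.1 hP).nonempty V hV)

/-- Restricting a noncrossing partition to a block of a coarser partition. -/
theorem IsNCPartition.restrict {P σ : Finset (Finset ι)} {S V : Finset ι}
    (hP : IsNCPartition P S) (hσ : IsNCPartition σ S) (hle : ∀ W ∈ P, ∃ V ∈ σ, W ⊆ V)
    (hV : V ∈ σ) : IsNCPartition (P.filter (· ⊆ V)) V where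
  nonempty W hW := hP.nonempty W (mem_filter.1 hW).1
  eq_of_mem W hW W' hW' := hP.eq_of_mem W (mem_filter.1 hW).1 W' (mem_filter.1 hW').1
  noncrossing W hW W' hW' := hP.noncrossing W (mem_filter.1 hW).1 W' (mem_filter.1 hW').1
  mem_iff i := by
    constructor
    · intro hi
      obtain ⟨W, hW, hiW⟩ := (hP.mem_iff i).1 (hσ.subset hV hi)
      obtain ⟨V', hV', hWV'⟩ := hle W hW
      obtain rfl := hσ.eq_of_mem V hV V' hV' i hi (hWV' hiW)
      exact ⟨W, mem_filter.2 ⟨hW, hWV'⟩, hiW⟩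
    · rintro ⟨W, hW, hi⟩
      exact (mem_filter.1 hW).2 hi

/-- Gluing noncrossing partitions of the blocks of a noncrossing partition. -/
theorem IsNCPartition.biUnion {σ : Finset (Finset ι)} {S : Finset ι} (hσ : IsNCPartition σ S)
    {p : ∀ V ∈ σ, Finset (Finset ι)} (hp : ∀ V hV, IsNCPartition (p V hV) V) :
    IsNCPartition (σ.attach.biUnion fun V => p V.1 V.2) S where
  nonempty W hW := by
    obtain ⟨V, -, hW⟩ := Finset.mem_biUnion.1 hW
    exact (hp _ _).nonempty W hW
  eq_of_mem W hW W' hW' i hi hi' := by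
    obtain ⟨⟨V, hV⟩, -, hW⟩ := Finset.mem_biUnion.1 hW
    obtain ⟨⟨V', hV'⟩, -, hW'⟩ := Finset.mem_biUnion.1 hW'
    obtain rfl := hσ.eq_of_mem V hV V' hV' i ((hp _ _).subset hW hi) ((hp _ _).subset hW' hi')
    exact (hp V hV).eq_of_mem W hW W' hW' i hi hi'
  noncrossing W hW W' hW' i j k l hij hjk hkl hi hk hj hl := by
    obtain ⟨⟨V, hV⟩, -, hW⟩ := Finset.mem_biUnion.1 hW
    obtain ⟨⟨V', hV'⟩, -, hW'⟩ := Finset.mem_biUnion.1 hW'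
    obtain rfl := hσ.noncrossing V hV V' hV' i j k l hij hjk hkl ((hp _ _).subset hW hi)
      ((hp _ _).subset hW hk) ((hp _ _).subset hW' hj) ((hp _ _).subset hW' hl)
    exact (hp V hV).noncrossing W hW W' hW' i j k l hij hjk hkl hi hk hj hl
  mem_iff i := by
    rw [hσ.mem_iff]
    constructor
    · rintro ⟨V, hV, hi⟩
      obtain ⟨W, hW, hi⟩ := ((hp V hV).mem_iff i).1 hi
      exact ⟨W, Finset.mem_biUnion.2 ⟨⟨V, hV⟩, mem_attach _ _, hW⟩, hi⟩
    · rintro ⟨W, hW, hi⟩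
      obtain ⟨⟨V, hV⟩, -, hW⟩ := Finset.mem_biUnion.1 hW
      exact ⟨V, hV, (hp V hV).subset hW hi⟩

/-- The interval below `σ` in the lattice of noncrossing partitions factorizes over the blocks. -/
theorem prod_ncSum {σ : Finset (Finset ι)} {S : Finset ι} (hσ : IsNCPartition σ S)
    [DecidablePred fun P : Finset (Finset ι) => ∀ W ∈ P, ∃ V ∈ σ, W ⊆ V] (w : Finset ι → B) :
    ∏ V ∈ σ, ncSum w V
      = ∑ P ∈ (ncParts S).filter (fun P => ∀ W ∈ P, ∃ V ∈ σ, W ⊆ V), ∏ W ∈ P, w W := by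
  have huniq : ∀ {V V' W : Finset ι}, V ∈ σ → V' ∈ σ → W ⊆ V → W ⊆ V' → W.Nonempty → V = V' :=
    fun hV hV' h h' ⟨i, hi⟩ => hσ.eq_of_mem _ hV _ hV' i (h hi) (h' hi)
  unfold ncSum
  rw [Finset.prod_sum]
  refine Finset.sum_bij' (fun p _ => σ.attach.biUnion fun V => p V.1 V.2)
    (fun P _ V _ => P.filter (· ⊆ V)) ?_ ?_ ?_ ?_ ?_
  · intro p hp
    have hp' : ∀ V hV, IsNCPartition (p V hV) V := fun V hV => mem_ncParts.1 (mem_pi.1 hp V hV)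
    refine mem_filter.2 ⟨mem_ncParts.2 (hσ.biUnion hp'), fun W hW => ?_⟩
    obtain ⟨⟨V, hV⟩, -, hW⟩ := Finset.mem_biUnion.1 hW
    exact ⟨V, hV, (hp' V hV).subset hW⟩
  · intro P hP
    obtain ⟨hP, hle⟩ := mem_filter.1 hP
    exact mem_pi.2 fun V hV => mem_ncParts.2 ((mem_ncParts.1 hP).restrict hσ hle hV)
  · intro p hp
    have hp' : ∀ V hV, IsNCPartition (p V hV) V := fun V hV => mem_ncParts.1 (mem_pi.1 hp V hV)
    funext V hV
    ext W
    simp only [mem_filter, Finset.mem_biUnion, mem_attach, true_and, Subtype.exists]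
    constructor
    · rintro ⟨⟨V', hV', hW⟩, hWV⟩
      obtain rfl := huniq hV hV' hWV ((hp' V' hV').subset hW) ((hp' V' hV').nonempty W hW)
      exact hW
    · exact fun hW => ⟨⟨V, hV, hW⟩, (hp' V hV).subset hW⟩
  · intro P hP
    obtain ⟨hP, hle⟩ := mem_filter.1 hP
    ext W
    simp only [mem_filter, Finset.mem_biUnion, mem_attach, true_and, Subtype.exists]
    constructor
    · rintro ⟨V, hV, hW, -⟩
      exact hW
    · intro hW
      obtain ⟨V, hV, h⟩ := hle W hW
      exact ⟨V, hV, hW, h⟩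
  · intro p hp
    have hp' : ∀ V hV, IsNCPartition (p V hV) V := fun V hV => mem_ncParts.1 (mem_pi.1 hp V hV)
    rw [Finset.prod_biUnion]
    rintro ⟨V, hV⟩ - ⟨V', hV'⟩ - hne
    refine Finset.disjoint_left.2 fun W hW hW' => hne (Subtype.ext ?_)
    exact huniq hV hV' ((hp' V hV).subset hW) ((hp' V' hV').subset hW') ((hp' V hV).nonempty W hW)

/-! ### Transport along order embeddings. -/

theorem IsNCPartition.map {P : Finset (Finset ι')} {S : Finset ι'} (h : IsNCPartition P S)
    (e : ι' ↪o ι) :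
    IsNCPartition (P.map (mapEmbedding e.toEmbedding).toEmbedding) (S.map e.toEmbedding) where
  nonempty V hV := by
    obtain ⟨V', hV', rfl⟩ := mem_map.1 hV
    exact (h.nonempty V' hV').map
  eq_of_mem V hV W hW i hi hi' := by
    obtain ⟨V', hV', rfl⟩ := mem_map.1 hV
    obtain ⟨W', hW', rfl⟩ := mem_map.1 hW
    obtain ⟨j, hj, rfl⟩ := mem_map.1 hi
    rw [h.eq_of_mem V' hV' W' hW' j hj ((mem_map' _).1 hi')]
  mem_iff i := by
    constructor
    · intro hi
      obtain ⟨i', hi', rfl⟩ := mem_map.1 hi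
      obtain ⟨V, hV, hi⟩ := (h.mem_iff i').1 hi'
      exact ⟨_, mem_map_of_mem _ hV, mem_map_of_mem _ hi⟩
    · rintro ⟨V, hV, hi⟩
      obtain ⟨V', hV', rfl⟩ := mem_map.1 hV
      obtain ⟨i', hi', rfl⟩ := mem_map.1 hi
      exact mem_map_of_mem _ (h.subset hV' hi')
  noncrossing V hV W hW i j k l hij hjk hkl hi hk hj hl := by
    obtain ⟨V', hV', rfl⟩ := mem_map.1 hV
    obtain ⟨W', hW', rfl⟩ := mem_map.1 hW
    obtain ⟨i', hi', rfl⟩ := mem_map.1 hi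
    obtain ⟨j', hj', rfl⟩ := mem_map.1 hj
    obtain ⟨k', hk', rfl⟩ := mem_map.1 hk
    obtain ⟨l', hl', rfl⟩ := mem_map.1 hl
    rw [h.noncrossing V' hV' W' hW' i' j' k' l' (e.lt_iff_lt.1 hij) (e.lt_iff_lt.1 hjk)
      (e.lt_iff_lt.1 hkl) hi' hk' hj' hl']

theorem IsNCPartition.of_map {P : Finset (Finset ι')} {S : Finset ι'} (e : ι' ↪o ι)
    (h : IsNCPartition (P.map (mapEmbedding e.toEmbedding).toEmbedding) (S.map e.toEmbedding)) :
    IsNCPartition P S where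
  nonempty V hV := by simpa using h.nonempty _ (mem_map_of_mem _ hV)
  eq_of_mem V hV W hW i hi hi' := by
    simpa using h.eq_of_mem _ (mem_map_of_mem _ hV) _ (mem_map_of_mem _ hW) (e i)
      (mem_map_of_mem _ hi) (mem_map_of_mem _ hi')
  mem_iff i := by simpa using h.mem_iff (e i)
  noncrossing V hV W hW i j k l hij hjk hkl hi hk hj hl := by
    simpa using h.noncrossing _ (mem_map_of_mem _ hV) _ (mem_map_of_mem _ hW) (e i) (e j) (e k)
      (e l) (e.lt_iff_lt.2 hij) (e.lt_iff_lt.2 hjk) (e.lt_iff_lt.2 hkl)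
      (mem_map_of_mem _ hi) (mem_map_of_mem _ hk) (mem_map_of_mem _ hj) (mem_map_of_mem _ hl)

theorem ncParts_map (e : ι' ↪o ι) (S : Finset ι') :
    ncParts (S.map e.toEmbedding)
      = (ncParts S).map (mapEmbedding (mapEmbedding e.toEmbedding).toEmbedding).toEmbedding := by
  ext P
  simp only [mem_ncParts, mem_map]
  constructor
  · intro h
    obtain ⟨Q, -, rfl⟩ : ∃ Q ⊆ S.powerset, Q.map (mapEmbedding e.toEmbedding).toEmbedding = P := by
      have : P ⊆ S.powerset.map (mapEmbedding e.toEmbedding).toEmbedding := by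
        intro V hV
        obtain ⟨W, hW, rfl⟩ := subset_map_iff.1 (h.subset hV)
        exact mem_map_of_mem _ (mem_powerset.2 hW)
      obtain ⟨Q, hQ, rfl⟩ := subset_map_iff.1 this
      exact ⟨Q, hQ, rfl⟩
    exact ⟨Q, h.of_map e, rfl⟩
  · rintro ⟨Q, hQ, rfl⟩
    exact hQ.map e

theorem ncSum_map (e : ι' ↪o ι) (w : Finset ι → B) (S : Finset ι') :
    ncSum w (S.map e.toEmbedding) = ncSum (fun V => w (V.map e.toEmbedding)) S := by
  rw [ncSum, ncParts_map, sum_map]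
  exact sum_congr rfl fun P _ => prod_map _ _ _

/-! ### Cumulants of a function of finite sets -/

open Classical in
/-- The solution `w` of the recursion `f S = ∑_{P ∈ NC(S)} ∏_{V ∈ P} w V`. -/
noncomputable def setCumulant (f : Finset ι → B) (S : Finset ι) : B :=
  f S - ∑ P ∈ ((ncParts S).erase {S}).attach, ∏ V ∈ P.1.attach, setCumulant f V.1
termination_by S.card
decreasing_by
  have hP := mem_ncParts.1 (mem_of_mem_erase P.2)
  -- A block equal to `S` would force the partition to be `{S}`, which was erased.
  refine card_lt_card ((hP.subset V.2).ssubset_of_ne fun h => ne_of_mem_erase P.2 ?_)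
  have hS : S ∈ P.1 := (congrArg (· ∈ P.1) h).mp V.2
  refine eq_singleton_iff_unique_mem.2 ⟨hS, fun W hW => ?_⟩
  obtain ⟨i, hi⟩ := hP.nonempty W hW
  exact hP.eq_of_mem W hW S hS i hi (hP.subset hW hi)

theorem ncSum_setCumulant (f : Finset ι → B) (hf : f ∅ = 1) (S : Finset ι) :
    ncSum (setCumulant f) S = f S := by
  classical
  rcases S.eq_empty_or_nonempty with rfl | hS
  · rw [ncSum_empty, hf]
  · rw [ncSum, ← add_sum_erase _ _ (mem_ncParts.2 (isNCPartition_singleton hS)), prod_singleton,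
      setCumulant, sum_attach ((ncParts S).erase {S}) fun P => ∏ V ∈ P.attach, setCumulant f V.1]
    simp_rw [fun P : Finset (Finset ι) => prod_attach P (setCumulant f)]
    convert sub_add_cancel _ _

end Combinatorics

/-! ### Möbius inversion on NC(n). -/

theorem isNCPartition_parts {n : ℕ} (π : NC n) : IsNCPartition π.1.parts Finset.univ where
  nonempty _ hV := π.1.nonempty_of_mem_parts hV
  eq_of_mem _ hV _ hW _ hi hi' := π.1.eq_of_mem_parts hV hW hi hi'
  mem_iff i := ⟨fun hi => π.1.exists_mem hi, fun _ => mem_univ i⟩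
  noncrossing := π.2

/-- A noncrossing partition of `Fin n` as an element of `NC n`. -/
def NC.ofIsNCPartition {n : ℕ} {P : Finset (Finset (Fin n))}
    (h : IsNCPartition P Finset.univ) : NC n :=
  ⟨{ parts := P
     supIndep := by
      rw [supIndep_iff_pairwiseDisjoint]
      intro V hV W hW hne
      exact Finset.disjoint_left.2 fun i hi hi' => hne (h.eq_of_mem V hV W hW i hi hi')
     sup_parts := by
      ext i
      simpa [mem_sup] using (h.mem_iff i).1 (mem_univ i)
     bot_notMem := fun hb => by simpa using h.nonempty _ hb }, h.noncrossing⟩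

open Classical in
theorem prod_parts_eq_sum_le {B : Type*} [CommRing B] {n : ℕ} {f w : Finset (Fin n) → B}
    (h : ∀ S, ncSum w S = f S) (σ : NC n) :
    ∏ V ∈ σ.1.parts, f V = ∑ π : NC n, if π ≤ σ then ∏ V ∈ π.1.parts, w V else 0 := by
  simp_rw [← h]
  rw [prod_ncSum (isNCPartition_parts σ), ← sum_filter]
  symm
  refine Finset.sum_bij (fun π _ => π.1.parts) ?_ ?_ ?_ ?_
  · intro π hπ
    refine mem_filter.2 ⟨mem_ncParts.2 (isNCPartition_parts π), fun W hW => ?_⟩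
    exact (mem_filter.1 hπ).2 hW
  · intro π _ π' _ heq
    exact Subtype.ext (Finpartition.ext heq)
  · intro P hP
    obtain ⟨hP, hle⟩ := mem_filter.1 hP
    refine ⟨NC.ofIsNCPartition (mem_ncParts.1 hP), mem_filter.2 ⟨mem_univ _, ?_⟩, rfl⟩
    intro W hW
    exact hle W hW
  · exact fun _ _ => rfl

theorem NC.le_one {n : ℕ} (π : NC n) : π ≤ NC.one n := by
  have : π.1 ≤ ⊤ := le_top
  exact this

/-- Möbius inversion: after exchanging the sums, the coefficient of the π-term is the sum of μ(σ,
1_n) over π ≤ σ ≤ 1_n, which vanishes unless π = 1_n. -/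
theorem sum_moebius_smul {B : Type*} [CommRing B] [Algebra ℂ B] {n : ℕ}
    {f w : Finset (Fin n) → B} (h : ∀ S, ncSum w S = f S) :
    ∑ σ : NC n, NC.moebius σ (NC.one n) • ∏ V ∈ σ.1.parts, f V
      = ∏ V ∈ (NC.one n).1.parts, w V := by
  classical
  simp_rw [prod_parts_eq_sum_le h, smul_sum]
  rw [sum_comm, Fintype.sum_eq_single (NC.one n)]
  · rw [Fintype.sum_eq_single (NC.one n)]
    · simp [NC.moebius]
    · intro σ hσ
      rw [if_neg fun hle => hσ (le_antisymm σ.le_one hle), smul_zero]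
  · intro π hπ
    have key := IncidenceAlgebra.sum_Icc_mu_left (𝕜 := ℂ) π (NC.one n)
    rw [if_neg hπ] at key
    simp_rw [smul_ite, smul_zero]
    rw [← sum_filter, ← sum_smul]
    convert zero_smul ℂ _
    rw [← key]
    refine sum_congr ?_ fun σ _ => ?_
    · ext σ
      simp [σ.le_one]
    · unfold NC.moebius
      congr!

/-! ### The moment-cumulant formula and the vanishing of alternating centred moments -/

section Moments

variable {N : ℕ} {A : Fin N → Type*} [∀ j, Ring (A j)] [∀ j, Algebra ℂ (A j)]
variable {ι ι' : Type*} [LinearOrder ι] [LinearOrder ι']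

/-- The moment of a family along a finite set of indices, in increasing order. -/
def setMoment (φ : ∀ j, A j →ₗ[ℂ] ℂ) (x : ι → ∀ j, A j) (V : Finset ι) : Diag N :=
  condExp φ ((V.sort (· ≤ ·)).map x).prod

theorem setMoment_empty (φ : ∀ j, A j →ₗ[ℂ] ℂ) (hφ : ∀ j, φ j 1 = 1) (x : ι → ∀ j, A j) :
    setMoment φ x ∅ = 1 := by
  ext j
  simp [setMoment, condExp, hφ]

theorem setMoment_map (φ : ∀ j, A j →ₗ[ℂ] ℂ) (x : ι → ∀ j, A j) (e : ι' ↪o ι) (V : Finset ι') :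
    setMoment φ x (V.map e.toEmbedding) = setMoment φ (x ∘ e) V := by
  have h : (V.map e.toEmbedding).sort (· ≤ ·) = (V.sort (· ≤ ·)).map e :=
    (Finset.map_sort (r := (· ≤ ·)) (r' := (· ≤ ·)) e.toEmbedding V
      fun a _ b _ => e.le_iff_le.symm).symm
  rw [setMoment, h, List.map_map, setMoment]

theorem parts_one {n : ℕ} (hn : n ≠ 0) : (NC.one n).1.parts = {Finset.univ} := by
  have hne : (Finset.univ : Finset (Fin n)).Nonempty := ⟨⟨0, Nat.pos_of_ne_zero hn⟩, mem_univ _⟩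
  refine (subset_singleton_iff.1 (Finpartition.parts_top_subset _)).resolve_left fun h => ?_
  obtain ⟨V, hV, -⟩ := (NC.one n).1.exists_mem hne.choose_spec
  exact notMem_empty V (h ▸ hV)

/-- Identifies the recursive cumulant with the Möbius one, by relabelling `V` increasingly by `Fin
#V`. Nonemptiness makes 1_n a single block. -/
theorem setCumulant_setMoment (φ : ∀ j, A j →ₗ[ℂ] ℂ) (hφ : ∀ j, φ j 1 = 1) (x : ι → ∀ j, A j)
    {V : Finset ι} (hV : V.Nonempty) :
    setCumulant (setMoment φ x) V = cumulant φ fun i => x (V.orderEmbOfFin rfl i) := by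
  set e := V.orderEmbOfFin rfl
  have h : ∀ W, ncSum (fun U => setCumulant (setMoment φ x) (U.map e.toEmbedding)) W
      = setMoment φ (x ∘ e) W := fun W => by
    rw [← ncSum_map, ncSum_setCumulant _ (setMoment_empty φ hφ x), setMoment_map]
  have := sum_moebius_smul h
  rw [parts_one hV.card_ne_zero, prod_singleton, map_orderEmbOfFin_univ] at this
  exact this.symm

theorem ncSum_cumulant (φ : ∀ j, A j →ₗ[ℂ] ℂ) (hφ : ∀ j, φ j 1 = 1) (x : ι → ∀ j, A j)
    (S : Finset ι) :
    ncSum (fun V => cumulant φ fun i => x (V.orderEmbOfFin rfl i)) S = setMoment φ x S := by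
  rw [← ncSum_setCumulant _ (setMoment_empty φ hφ x) S]
  exact ncSum_congr fun V _ hV => (setCumulant_setMoment φ hφ x hV).symm

/-- If neighbours have different colours, a noncrossing partition has a block with one element or
a block with two colours. -/
theorem IsNCPartition.exists_singleton_or_mixed {n : ℕ} (hn : n ≠ 0) {P : Finset (Finset (Fin n))}
    (hP : IsNCPartition P Finset.univ) {c : Fin n → Bool}
    (hc : ∀ i k : Fin n, (i : ℕ) + 1 = k → c i ≠ c k) :
    (∃ i, {i} ∈ P) ∨ ∃ V ∈ P, ∃ i ∈ V, ∃ k ∈ V, c i ≠ c k := by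
  by_contra! h
  obtain ⟨hs, hm⟩ := h
  have hother : ∀ V ∈ P, ∀ i ∈ V, ∃ k ∈ V, k ≠ i := by
    intro V hV i hi
    by_contra! hk
    exact hs i ((eq_singleton_iff_unique_mem.2 ⟨hi, hk⟩) ▸ hV)
  -- Infinite descent on the distance of two points of one block. Blocks are monochromatic, so
  -- neighbours never share one. Thus `i + 1` lies in another block, and noncrossing traps a second
  -- point of that block before `k`, giving a closer pair.
  have main : ∀ d : ℕ, ∀ V ∈ P, ∀ i ∈ V, ∀ k ∈ V, i < k → (k : ℕ) - i = d → False := by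
    intro d
    induction d using Nat.strong_induction_on with
    | _ d ih =>
      intro V hV i hi k hk hik hd
      have h1 : (i : ℕ) + 1 ≠ k := fun h1 => hc i k h1 (hm V hV i hi k hk)
      have hik' : (i : ℕ) < k := hik
      obtain ⟨W, hW, hmW⟩ := (hP.mem_iff ⟨i + 1, by omega⟩).1 (mem_univ _)
      set m : Fin n := ⟨i + 1, by omega⟩ with hm_def
      have hmv : (m : ℕ) = i + 1 := rfl
      have him : i < m := Fin.lt_def.2 (by omega)
      have hmk : m < k := Fin.lt_def.2 (by omega)
      have hVW : V ≠ W := by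
        rintro rfl
        exact ih _ (by omega) V hV i hi m hmW him rfl
      obtain ⟨l, hl, hlm⟩ := hother W hW m hmW
      have hli : l ≠ i := fun h => hVW (hP.eq_of_mem V hV W hW i hi (h ▸ hl))
      have hlk : l ≠ k := fun h => hVW (hP.eq_of_mem V hV W hW k hk (h ▸ hl))
      rcases lt_or_gt_of_ne hlm with hlt | hgt
      · rcases lt_or_gt_of_ne hli with hlt' | hgt'
        · exact hVW (hP.noncrossing W hW V hV l i m k hlt' him hmk hl hmW hi hk).symm
        · have : (l : ℕ) < m := hlt
          have : (i : ℕ) < l := hgt'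
          omega
      · rcases lt_or_gt_of_ne hlk with hlt' | hgt'
        · have : (m : ℕ) < l := hgt
          have : (l : ℕ) < k := hlt'
          exact ih _ (by omega) W hW m hmW l hl hgt rfl
        · exact hVW (hP.noncrossing V hV W hW i m k l him hmk hgt' hi hk hmW hl)
  obtain ⟨V, hV, hi⟩ := (hP.mem_iff ⟨0, Nat.pos_of_ne_zero hn⟩).1 (mem_univ _)
  obtain ⟨k, hk, hne⟩ := hother V hV _ hi
  exact main _ V hV _ hi k hk (lt_of_le_of_ne (Fin.le_def.2 (Nat.zero_le _)) hne.symm) rfl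

/-- If all mixed cumulants of two subalgebras vanish, so do alternating moments of centred
elements. -/
theorem FreeSubalgebras.condExp_prod_eq_zero {φ : ∀ j, A j →ₗ[ℂ] ℂ} (hφ : ∀ j, φ j 1 = 1)
    {A₁ A₂ : Subalgebra ℂ (∀ j, A j)} (h : FreeSubalgebras φ A₁ A₂) {n : ℕ} (hn : n ≠ 0)
    {c : Fin n → Bool} (hc : ∀ i k : Fin n, (i : ℕ) + 1 = k → c i ≠ c k) {a : Fin n → ∀ j, A j}
    (h₁ : ∀ i, c i = true → a i ∈ A₁) (h₂ : ∀ i, c i = false → a i ∈ A₂)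
    (h0 : ∀ i, condExp φ (a i) = 0) : condExp φ (List.ofFn a).prod = 0 := by
  have hm : setMoment φ a Finset.univ = condExp φ (List.ofFn a).prod := by
    rw [setMoment, Fin.sort_univ, List.ofFn_eq_map]
  rw [← hm, ← ncSum_cumulant φ hφ, ncSum]
  refine sum_eq_zero fun P hP => ?_
  rcases (mem_ncParts.1 hP).exists_singleton_or_mixed hn hc with ⟨i, hi⟩ | ⟨V, hV, i, hi, k, hk, hik⟩
  · refine prod_eq_zero hi ?_
    have : (fun l => a (({i} : Finset (Fin n)).orderEmbOfFin rfl l)) = fun _ : Fin 1 => a i := by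
      funext l
      rw [mem_singleton.1 (orderEmbOfFin_mem {i} rfl l)]
    change cumulant φ (n := 1) _ = 0
    rw [this, cumulant_one, h0]
  · refine prod_eq_zero hV ?_
    refine h _ (fun l => c (V.orderEmbOfFin rfl l)) _ (fun l => h₁ _) (fun l => h₂ _) ?_
    rw [← mem_coe, ← range_orderEmbOfFin V rfl] at hi hk
    obtain ⟨i, rfl⟩ := hi
    obtain ⟨k, rfl⟩ := hk
    exact ⟨i, k, hik⟩

end Moments

/-! ### The functional equation relating moments and cumulants -/

section FunctionalEquation

variable {B : Type*} [CommRing B]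

open Classical in
/-- The weight `w`, set to zero on the sets that are separated by an element of `U`. -/
noncomputable def cutWeight (w : Finset ℕ → B) (U V : Finset ℕ) : B :=
  if ∃ u ∈ U, ∃ b ∈ V, ∃ b' ∈ V, b < u ∧ u < b' then 0 else w V

@[simp] theorem cutWeight_empty (w : Finset ℕ → B) : cutWeight w ∅ = w := by
  funext V
  simp [cutWeight]

open Classical in
theorem ncSum_cutWeight (w : Finset ℕ → B) (U S : Finset ℕ) :
    ncSum (cutWeight w U) S = ∑ P ∈ (ncParts S).filter
      (fun P => ∀ V ∈ P, ¬ ∃ u ∈ U, ∃ b ∈ V, ∃ b' ∈ V, b < u ∧ u < b'), ∏ V ∈ P, w V := by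
  rw [ncSum, sum_filter]
  refine sum_congr rfl fun P _ => ?_
  split_ifs with h
  · exact prod_congr rfl fun V hV => if_neg (h V hV)
  · push Not at h
    obtain ⟨V, hV, h⟩ := h
    exact prod_eq_zero hV (if_pos h)

/-- Adding a block that contains the last element. -/
theorem IsNCPartition.insert_last {n : ℕ} {S U : Finset ℕ} {Q : Finset (Finset ℕ)}
    (hS : ∀ i ∈ S, i < n) (hU : U ⊆ S) (hQ : IsNCPartition Q (S \ U))
    (hcut : ∀ V ∈ Q, ¬ ∃ u ∈ U, ∃ b ∈ V, ∃ b' ∈ V, b < u ∧ u < b') :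
    IsNCPartition (insert (insert n U) Q) (insert n S) where
  nonempty V hV := by
    rcases mem_insert.1 hV with rfl | hV
    · exact insert_nonempty _ _
    · exact hQ.nonempty V hV
  eq_of_mem := by
    have key : ∀ V ∈ Q, ∀ i ∈ V, i ∉ insert n U := by
      intro V hV i hi h
      have hiS := mem_sdiff.1 (hQ.subset hV hi)
      rcases mem_insert.1 h with rfl | h
      · exact lt_irrefl _ (hS _ hiS.1)
      · exact hiS.2 h
    intro V hV W hW i hi hi'
    rcases mem_insert.1 hV with rfl | hV <;> rcases mem_insert.1 hW with rfl | hW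
    · rfl
    · exact absurd hi (key W hW i hi')
    · exact absurd hi' (key V hV i hi)
    · exact hQ.eq_of_mem V hV W hW i hi hi'
  mem_iff i := by
    have := hQ.mem_iff i
    simp only [mem_insert, exists_eq_or_imp, ← this, mem_sdiff]
    have := @hU i
    tauto
  noncrossing := by
    have hlt : ∀ V ∈ Q, ∀ i ∈ V, i < n := fun V hV i hi => hS i (mem_sdiff.1 (hQ.subset hV hi)).1
    have hle : ∀ i ∈ insert n U, i ≤ n := by
      intro i hi
      rcases mem_insert.1 hi with rfl | hi
      · exact le_rfl
      · exact (hS i (hU hi)).le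
    intro V hV W hW i j k l hij hjk hkl hi hk hj hl
    rcases mem_insert.1 hV with rfl | hV <;> rcases mem_insert.1 hW with rfl | hW
    · rfl
    · have hkn : k < n := hkl.trans (hlt W hW l hl)
      exact absurd ⟨k, (mem_insert.1 hk).resolve_left hkn.ne, j, hj, l, hl, hjk, hkl⟩ (hcut W hW)
    · have hjn : j < n := hjk.trans (hlt V hV k hk)
      exact absurd ⟨j, (mem_insert.1 hj).resolve_left hjn.ne, i, hi, k, hk, hij, hjk⟩ (hcut V hV)
    · exact hQ.noncrossing V hV W hW i j k l hij hjk hkl hi hk hj hl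

/-- Removing the block that contains the last element. -/
theorem IsNCPartition.erase_last {n : ℕ} {S V₀ : Finset ℕ} {P : Finset (Finset ℕ)}
    (hS : ∀ i ∈ S, i < n) (hP : IsNCPartition P (insert n S)) (hV₀ : V₀ ∈ P) (hn : n ∈ V₀) :
    IsNCPartition (P.erase V₀) (S \ V₀.erase n) ∧
      ∀ V ∈ P.erase V₀, ¬ ∃ u ∈ V₀.erase n, ∃ b ∈ V, ∃ b' ∈ V, b < u ∧ u < b' := by
  have hlt : ∀ V ∈ P.erase V₀, ∀ i ∈ V, i < n := by
    intro V hV i hi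
    rcases mem_insert.1 (hP.subset (mem_of_mem_erase hV) hi) with rfl | h
    · exact absurd (hP.eq_of_mem V (mem_of_mem_erase hV) V₀ hV₀ i hi hn) (ne_of_mem_erase hV)
    · exact hS i h
  refine ⟨⟨fun V hV => hP.nonempty V (mem_of_mem_erase hV),
    fun V hV W hW => hP.eq_of_mem V (mem_of_mem_erase hV) W (mem_of_mem_erase hW), fun i => ?_,
    fun V hV W hW => hP.noncrossing V (mem_of_mem_erase hV) W (mem_of_mem_erase hW)⟩, ?_⟩
  · constructor
    · intro hi
      obtain ⟨hiS, hi⟩ := mem_sdiff.1 hi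
      obtain ⟨V, hV, hiV⟩ := (hP.mem_iff i).1 (mem_insert_of_mem hiS)
      refine ⟨V, mem_erase.2 ⟨?_, hV⟩, hiV⟩
      rintro rfl
      exact hi (mem_erase.2 ⟨(hS i hiS).ne, hiV⟩)
    · rintro ⟨V, hV, hi⟩
      refine mem_sdiff.2 ⟨(mem_insert.1 (hP.subset (mem_of_mem_erase hV) hi)).resolve_left
        (hlt V hV i hi).ne, fun h => ne_of_mem_erase hV ?_⟩
      exact hP.eq_of_mem V (mem_of_mem_erase hV) V₀ hV₀ i hi (mem_of_mem_erase h)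
  · rintro V hV ⟨u, hu, b, hb, b', hb', h1, h2⟩
    exact ne_of_mem_erase hV (hP.noncrossing V (mem_of_mem_erase hV) V₀ hV₀ b u b' n h1 h2
      (hlt V hV b' hb') hb hb' (mem_of_mem_erase hu) hn)

/-- Expansion of a sum over noncrossing partitions along the block of the last element. -/
theorem ncSum_insert_last {n : ℕ} {S : Finset ℕ} (hS : ∀ i ∈ S, i < n) (w : Finset ℕ → B) :
    ncSum w (insert n S)
      = ∑ U ∈ S.powerset, w (insert n U) * ncSum (cutWeight w U) (S \ U) := by
  classical
  simp_rw [ncSum_cutWeight, mul_sum]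
  rw [sum_sigma', ncSum]
  symm
  have hnotMem : ∀ {U : Finset ℕ} {Q : Finset (Finset ℕ)}, IsNCPartition Q (S \ U) →
      ∀ V ∈ Q, n ∉ V := fun hQ V hV hn =>
    lt_irrefl n (hS n (mem_sdiff.1 (hQ.subset hV hn)).1)
  have hnU : ∀ {U : Finset ℕ}, U ⊆ S → n ∉ U := fun hU hn => lt_irrefl n (hS n (hU hn))
  -- `U` is the block of `n` without `n`, `Q` the remaining blocks. As `n` is last, the block of `n`
  -- crosses no block of `Q` exactly when no point of `U` separates such a block.
  refine sum_bij (fun x _ => insert (insert n x.1) x.2) ?_ ?_ ?_ ?_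
  · rintro ⟨U, Q⟩ hx
    simp only [mem_sigma, mem_powerset, mem_filter, mem_ncParts] at hx
    exact mem_ncParts.2 (hx.2.1.insert_last hS hx.1 hx.2.2)
  · rintro ⟨U, Q⟩ hx ⟨U', Q'⟩ hx' heq
    simp only [mem_sigma, mem_powerset, mem_filter, mem_ncParts] at hx hx'
    dsimp only at heq
    have h1 : insert n U = insert n U' := by
      have : insert n U ∈ insert (insert n U') Q' := heq ▸ mem_insert_self _ _
      exact (mem_insert.1 this).resolve_right fun h =>
        hnotMem hx'.2.1 _ h (mem_insert_self _ _)
    obtain rfl : U = U' := by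
      rw [← erase_insert (hnU hx.1), h1, erase_insert (hnU hx'.1)]
    obtain rfl : Q = Q' := by
      rw [← erase_insert fun h => hnotMem hx.2.1 _ h (mem_insert_self n U), heq,
        erase_insert fun h => hnotMem hx'.2.1 _ h (mem_insert_self n U)]
    rfl
  · intro P hP
    replace hP := mem_ncParts.1 hP
    obtain ⟨V₀, hV₀, hn⟩ := (hP.mem_iff n).1 (mem_insert_self _ _)
    have hsub : V₀.erase n ⊆ S := fun i hi =>
      (mem_insert.1 (hP.subset hV₀ (mem_of_mem_erase hi))).resolve_left (ne_of_mem_erase hi)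
    obtain ⟨h1, h2⟩ := hP.erase_last hS hV₀ hn
    refine ⟨⟨V₀.erase n, P.erase V₀⟩, ?_, ?_⟩
    · simp only [mem_sigma, mem_powerset, mem_filter, mem_ncParts]
      exact ⟨hsub, h1, h2⟩
    · dsimp only
      rw [insert_erase hn, insert_erase hV₀]
  · rintro ⟨U, Q⟩ hx
    simp only [mem_sigma, mem_powerset, mem_filter, mem_ncParts] at hx
    dsimp only
    rw [prod_insert fun h => hnotMem hx.2.1 _ h (mem_insert_self n U)]

/-- Factorization of a sum over noncrossing partitions when no block meets both of two consecutive
sets. -/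
theorem ncSum_union {S T : Finset ℕ} {w : Finset ℕ → B} (hlt : ∀ s ∈ S, ∀ t ∈ T, s < t)
    (hw : ∀ V : Finset ℕ, (∃ s ∈ S, s ∈ V) → (∃ t ∈ T, t ∈ V) → w V = 0) :
    ncSum w (S ∪ T) = ncSum w S * ncSum w T := by
  classical
  rcases S.eq_empty_or_nonempty with rfl | hS
  · simp
  rcases T.eq_empty_or_nonempty with rfl | hT
  · simp
  have hdisj : ∀ i, i ∈ S → i ∈ T → False := fun i hi hi' => lt_irrefl i (hlt i hi i hi')
  have hne : S ≠ T := by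
    rintro rfl
    exact hdisj _ hS.choose_spec hS.choose_spec
  have hσ : IsNCPartition {S, T} (S ∪ T) := by
    refine ⟨?_, ?_, ?_, ?_⟩
    · simp [hS, hT]
    · intro V hV W hW i hi hi'
      simp only [mem_insert, mem_singleton] at hV hW
      rcases hV with rfl | rfl <;> rcases hW with rfl | rfl
      · rfl
      · exact (hdisj i hi hi').elim
      · exact (hdisj i hi' hi).elim
      · rfl
    · simp
    · intro V hV W hW i j k l hij hjk hkl hi hk hj hl
      simp only [mem_insert, mem_singleton] at hV hW
      rcases hV with rfl | rfl <;> rcases hW with rfl | rfl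
      · rfl
      · exact absurd (hlt k hk j hj) hjk.not_gt
      · exact absurd (hlt j hj i hi) hij.not_gt
      · rfl
  -- The product is the sum over partitions finer than `{S, T}`; all others contain a block of
  -- weight 0.
  rw [← prod_pair hne, prod_ncSum hσ, ncSum]
  symm
  refine sum_filter_of_ne fun P hP hprod V hV => ?_
  have hsub := (mem_ncParts.1 hP).subset hV
  by_cases h1 : ∃ s ∈ S, s ∈ V
  · by_cases h2 : ∃ t ∈ T, t ∈ V
    · exact absurd (prod_eq_zero hV (hw V h1 h2)) hprod
    · refine ⟨S, by simp, fun i hi => (mem_union.1 (hsub hi)).resolve_right fun h => h2 ⟨i, h, hi⟩⟩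
  · exact ⟨T, by simp, fun i hi => (mem_union.1 (hsub hi)).resolve_left fun h => h1 ⟨i, h, hi⟩⟩

/-- As `i` is the largest cut point, no block of nonzero weight passes over it. To its right no cut
acts any more, and to its left only those of `U` do. -/
theorem ncSum_cutWeight_insert {i n : ℕ} (hin : i < n) {U : Finset ℕ} (hU : U ⊆ range i)
    (w : Finset ℕ → B) :
    ncSum (cutWeight w (insert i U)) (range n \ insert i U)
      = ncSum (cutWeight w U) (range i \ U) * ncSum w (Ico (i + 1) n) := by
  have hU' : ∀ u ∈ U, u < i := fun u hu => mem_range.1 (hU hu)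
  have hset : range n \ insert i U = (range i \ U) ∪ Ico (i + 1) n := by
    ext l
    have := hU' l
    simp only [mem_sdiff, mem_range, mem_insert, mem_union, mem_Ico, not_or]
    constructor
    · rintro ⟨h1, h2, h3⟩
      by_cases h : l < i
      · exact Or.inl ⟨h, h3⟩
      · exact Or.inr (by omega)
    · rintro (⟨h1, h2⟩ | h)
      · exact ⟨by omega, by omega, h2⟩
      · exact ⟨by omega, by omega, fun h' => by have := this h'; omega⟩
  rw [hset, ncSum_union]
  · congr 1
    · refine ncSum_congr fun V hV _ => ?_
      have hVi : ∀ b ∈ V, b < i := fun b hb => mem_range.1 (mem_sdiff.1 (hV hb)).1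
      unfold cutWeight
      refine if_congr ?_ rfl rfl
      constructor
      · rintro ⟨u, hu, b, hb, b', hb', h1, h2⟩
        rcases mem_insert.1 hu with rfl | hu
        · exact absurd (hVi b' hb') h2.not_gt
        · exact ⟨u, hu, b, hb, b', hb', h1, h2⟩
      · rintro ⟨u, hu, h⟩
        exact ⟨u, mem_insert_of_mem hu, h⟩
    · refine ncSum_congr fun V hV _ => if_neg ?_
      rintro ⟨u, hu, b, hb, -, -, h1, -⟩
      have h2 := (mem_Ico.1 (hV hb)).1
      rcases mem_insert.1 hu with rfl | hu
      · omega
      · have := hU' u hu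
        omega
  · intro s hs t ht
    have := mem_range.1 (mem_sdiff.1 hs).1
    have := (mem_Ico.1 ht).1
    omega
  · rintro V ⟨s, hs, hsV⟩ ⟨t, ht, htV⟩
    exact if_pos ⟨i, mem_insert_self _ _, s, hsV, t, htV, mem_range.1 (mem_sdiff.1 hs).1,
      (mem_Ico.1 ht).1⟩

/-- Sorts the subsets by their largest element. -/
theorem sum_powerset_range_eq (F : Finset ℕ → B) (n : ℕ) :
    ∑ U ∈ (range n).powerset, F U
      = F ∅ + ∑ i ∈ range n, ∑ U ∈ (range i).powerset, F (insert i U) := by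
  induction n with
  | zero => simp
  | succ n ih =>
    rw [sum_range_succ, ← add_assoc, ← ih, range_add_one, sum_powerset_insert notMem_range_self]

variable {k m : ℕ → B}

/-- Sums over noncrossing partitions of `{0, …, n}`, where the block of the last element is
weighted as if it had `j` elements more than its elements in `{0, …, n - 1}`. -/
noncomputable def lastBlockSum (k : ℕ → B) (j n : ℕ) : B :=
  ∑ U ∈ (range n).powerset, k (#U + j) * ncSum (cutWeight (fun V => k #V) U) (range n \ U)

/-- Peels off the largest element `i` of `U`: it is counted in `j + 1`, and the gap between `i` and
`n` contributes a free moment. -/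
theorem lastBlockSum_eq (hm : ∀ S : Finset ℕ, ncSum (fun V => k #V) S = m #S) (j n : ℕ) :
    lastBlockSum k j n
      = k j * m n + ∑ i ∈ range n, lastBlockSum k (j + 1) i * m (n - (i + 1)) := by
  rw [lastBlockSum, sum_powerset_range_eq]
  congr 1
  · simp [hm]
  · refine sum_congr rfl fun i hi => ?_
    rw [lastBlockSum, sum_mul]
    refine sum_congr rfl fun U hU => ?_
    have hU := mem_powerset.1 hU
    rw [ncSum_cutWeight_insert (mem_range.1 hi) hU, hm, Nat.card_Ico,
      card_insert_of_notMem fun h => notMem_range_self (hU h), mul_assoc, add_assoc, add_comm 1 j]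

theorem moment_succ (hm : ∀ S : Finset ℕ, ncSum (fun V => k #V) S = m #S) (n : ℕ) :
    m (n + 1) = lastBlockSum k 1 n := by
  have := hm (range (n + 1))
  rw [card_range] at this
  rw [← this, range_add_one, ncSum_insert_last fun i hi => mem_range.1 hi]
  refine sum_congr rfl fun U hU => ?_
  rw [card_insert_of_notMem fun h => notMem_range_self (mem_powerset.1 hU h)]

/-! ### Generating series of the recursion. -/

open PowerSeries

theorem coeff_pow_eq_zero_of_lt {R : Type*} [CommRing R] {u : R⟦X⟧} (hu : constantCoeff u = 0)
    {d n : ℕ} (h : d < n) : coeff d (u ^ n) = 0 :=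
  X_pow_dvd_iff.1 (pow_dvd_pow_of_dvd (X_dvd_iff.2 hu) n) d h

theorem coeff_subst_eq_sum {R : Type*} [CommRing R] {u : R⟦X⟧} (hu : constantCoeff u = 0)
    (f : R⟦X⟧) {d n : ℕ} (h : d < n) :
    coeff d (f.subst u) = ∑ i ∈ range n, coeff i f * coeff d (u ^ i) := by
  rw [coeff_subst' (HasSubst.of_constantCoeff_zero' hu),
    finsum_eq_sum_of_support_subset (s := range n)]
  · simp
  · intro i hi
    by_contra hin
    refine hi ?_
    have : n ≤ i := by simpa using hin
    simp [coeff_pow_eq_zero_of_lt hu (h.trans_le this)]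

theorem mk_lastBlockSum (hm : ∀ S : Finset ℕ, ncSum (fun V => k #V) S = m #S) (j : ℕ) :
    PowerSeries.mk (lastBlockSum k j) = C (k j) * PowerSeries.mk m
      + X * (PowerSeries.mk m * PowerSeries.mk (lastBlockSum k (j + 1))) := by
  ext n
  rw [map_add, coeff_C_mul, coeff_mk, coeff_mk, lastBlockSum_eq hm]
  congr 1
  cases n with
  | zero => simp
  | succ n =>
    rw [coeff_succ_X_mul, mul_comm, coeff_mul, Nat.sum_antidiagonal_eq_sum_range_succ_mk]
    refine sum_congr rfl fun i _ => ?_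
    simp

/-- Iterates L_j = k_j M + z M L_{j+1}, starting from M = 1 + z L_1. The remainder is divisible by
z^(n+1), so it is invisible in low degree. -/
theorem mk_moment_eq_add (hm : ∀ S : Finset ℕ, ncSum (fun V => k #V) S = m #S) (n : ℕ) :
    PowerSeries.mk m = 1 + ∑ i ∈ range n, C (k (i + 1)) * (X * PowerSeries.mk m) ^ (i + 1)
      + (X * PowerSeries.mk m) ^ n * (X * PowerSeries.mk (lastBlockSum k (n + 1))) := by
  induction n with
  | zero =>
    ext d
    cases d with
    | zero => simpa using (hm ∅).symm
    | succ d => simp [coeff_succ_X_mul, moment_succ hm, coeff_one]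
  | succ n ih =>
    rw [sum_range_succ]
    conv_lhs => rw [ih, mk_lastBlockSum hm (n + 1)]
    ring

/-- The functional equation `M(z) = 1 + R(z M(z))` of the moment series `M` and the cumulant
series `R`. -/
theorem mk_moment_eq_subst (hm : ∀ S : Finset ℕ, ncSum (fun V => k #V) S = m #S) :
    PowerSeries.mk m
      = 1 + (PowerSeries.mk fun n => if n = 0 then 0 else k n).subst (X * PowerSeries.mk m) := by
  have h0 : constantCoeff (X * PowerSeries.mk m) = 0 := by simp
  ext d
  conv_lhs => rw [mk_moment_eq_add hm (d + 1)]
  rw [map_add, map_add, map_add, coeff_subst_eq_sum h0 _ (n := d + 2) (by omega),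
    sum_range_succ' _ (d + 1)]
  have h : coeff d ((X * PowerSeries.mk m) ^ (d + 1) *
      (X * PowerSeries.mk (lastBlockSum k (d + 1 + 1)))) = 0 :=
    X_pow_dvd_iff.1 ((pow_dvd_pow_of_dvd (X_dvd_iff.2 h0) (d + 1)).mul_right _) d (by omega)
  rw [h]
  simp [map_sum, coeff_C_mul]

end FunctionalEquation

/-! ### Alternating products -/

section Alternating

variable {B A : Type*} [CommRing B] [Ring A] [Algebra B A]

/-- The colour of the `i`-th letter of an alternating word that begins with colour `c`. -/
def altColor (c : Bool) (i : ℕ) : Bool := xor c i.bodd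

/-- Alternating products of centred elements of the subalgebras `S true`, `S false` are centred. -/
def IsAltFree (E : A →ₗ[B] B) (S : Bool → Subalgebra B A) : Prop :=
  ∀ (c : Bool) (n : ℕ) (a : Fin (n + 1) → A), (∀ i : Fin (n + 1), a i ∈ S (altColor c i)) →
    (∀ i, E (a i) = 0) → E (List.ofFn a).prod = 0

/-- The centred elements of a subalgebra. -/
def centred (E : A →ₗ[B] B) (S : Subalgebra B A) : Submodule B A :=
  Subalgebra.toSubmodule S ⊓ LinearMap.ker E

/-- The span of the alternating products of `n` centred elements, the first of colour `c`. -/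
def altSpan (E : A →ₗ[B] B) (S : Bool → Subalgebra B A) : Bool → ℕ → Submodule B A
  | _, 0 => 1
  | c, n + 1 => centred E (S c) * altSpan E S (!c) n

/-- Freeness concerns single words, while coefficients of products of series are sums of words; this
bridges the two. -/
theorem altSpan_le (E : A →ₗ[B] B) (S : Bool → Subalgebra B A) (c : Bool) (n : ℕ) :
    altSpan E S c n ≤ Submodule.span B {p | ∃ a : Fin n → A,
      (∀ i : Fin n, a i ∈ centred E (S (altColor c i))) ∧ (List.ofFn a).prod = p} := by
  induction n generalizing c with
  | zero =>
    rw [altSpan, Submodule.one_eq_span]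
    exact Submodule.span_mono (by simp)
  | succ n ih =>
    rw [altSpan]
    refine (mul_le_mul_right (ih (!c)) _).trans ?_
    rw [← Submodule.span_eq (centred E (S c)), Submodule.span_mul_span]
    refine Submodule.span_mono ?_
    rintro _ ⟨p, hp, _, ⟨a, ha, rfl⟩, rfl⟩
    refine ⟨Fin.cons p a, fun i => ?_, by simp⟩
    refine Fin.cases ?_ (fun i => ?_) i
    · simpa [altColor] using hp
    · have : altColor c (i.succ : Fin (n + 1)) = altColor (!c) i := by
        simp [altColor, Nat.bodd_succ]
      rw [this]
      exact ha i

theorem IsAltFree.eq_zero_of_mem {E : A →ₗ[B] B} {S : Bool → Subalgebra B A} (h : IsAltFree E S)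
    {c : Bool} {n : ℕ} {p : A} (hp : p ∈ altSpan E S c (n + 1)) : E p = 0 := by
  have hle : Submodule.span B {p | ∃ a : Fin (n + 1) → A,
      (∀ i : Fin (n + 1), a i ∈ centred E (S (altColor c i))) ∧ (List.ofFn a).prod = p}
      ≤ LinearMap.ker E := by
    rw [Submodule.span_le]
    rintro _ ⟨a, ha, rfl⟩
    exact h c n a (fun i => (ha i).1) fun i => (ha i).2
  exact hle (altSpan_le E S c (n + 1) hp)

end Alternating

/-! ### Power series over a noncommutative algebra -/

section Series

open PowerSeries

variable {B A : Type*} [CommRing B] [Ring A] [Algebra B A]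

/-- Power series over a `B`-algebra form an algebra over the power series over `B`. -/
noncomputable instance seriesAlgebra : Algebra B⟦X⟧ A⟦X⟧ :=
  RingHom.toAlgebra' (PowerSeries.map (algebraMap B A)) fun f g => by
    ext n
    rw [coeff_mul, coeff_mul, ← Nat.sum_antidiagonal_swap]
    exact sum_congr rfl fun p _ => by simp [Algebra.commutes]

theorem series_smul_def (f : B⟦X⟧) (g : A⟦X⟧) :
    f • g = PowerSeries.map (algebraMap B A) f * g := rfl

theorem coeff_series_smul (f : B⟦X⟧) (g : A⟦X⟧) (n : ℕ) :
    coeff n (f • g) = ∑ p ∈ antidiagonal n, coeff p.1 f • coeff p.2 g := by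
  rw [series_smul_def, coeff_mul]
  exact sum_congr rfl fun p _ => by rw [coeff_map, Algebra.smul_def]

theorem series_X_smul (g : A⟦X⟧) : (X : B⟦X⟧) • g = X * g := by
  rw [series_smul_def, PowerSeries.map_X]

theorem series_smul_C (f : B⟦X⟧) (a : A) (n : ℕ) :
    coeff n (f • (C a : A⟦X⟧)) = coeff n f • a := by
  rw [series_smul_def, coeff_mul_C, coeff_map, Algebra.smul_def]

/-- The coefficientwise extension of a linear functional to power series. -/
noncomputable def seriesExp (E : A →ₗ[B] B) : A⟦X⟧ →ₗ[B⟦X⟧] B⟦X⟧ where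
  toFun f := PowerSeries.mk fun n => E (coeff n f)
  map_add' f g := by ext n; simp
  map_smul' f g := by
    ext n
    simp [coeff_series_smul, coeff_mul, map_sum]

@[simp] theorem coeff_seriesExp (E : A →ₗ[B] B) (f : A⟦X⟧) (n : ℕ) :
    coeff n (seriesExp E f) = E (coeff n f) := by
  change coeff n (PowerSeries.mk fun n => E (coeff n f)) = _
  rw [coeff_mk]

theorem seriesExp_one {E : A →ₗ[B] B} (hE : E 1 = 1) : seriesExp E 1 = 1 := by
  ext n
  rw [coeff_seriesExp, coeff_one, coeff_one]
  split_ifs <;> simp [hE]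

theorem seriesExp_eq_zero {E : A →ₗ[B] B} {f : A⟦X⟧} (h : ∀ n, E (coeff n f) = 0) :
    seriesExp E f = 0 := by
  ext n
  simp [h]

theorem coeff_mul_mem {M M' : Submodule B A} {f g : A⟦X⟧} (hf : ∀ n, coeff n f ∈ M)
    (hg : ∀ n, coeff n g ∈ M') (n : ℕ) : coeff n (f * g) ∈ M * M' := by
  rw [coeff_mul]
  exact Submodule.sum_mem _ fun p _ => Submodule.mul_mem_mul (hf _) (hg _)

/-- Iterates g = 1 + g q. Keeping the remainder avoids any notion of convergence. -/
theorem eq_geom_sum_add {R : Type*} [Ring R] {g q : R} (h : g * (1 - q) = 1) (n : ℕ) :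
    g = ∑ i ∈ range n, q ^ i + g * q ^ n := by
  induction n with
  | zero => simp
  | succ n ih =>
    rw [sum_range_succ, pow_succ', ← mul_assoc, add_assoc]
    have hg : g * q = g - 1 := by rw [mul_sub, mul_one] at h; rw [← h]; abel
    rw [hg, sub_mul, one_mul, add_sub_cancel]
    exact ih

theorem coeff_mul_X_smul_pow_mul {u : B⟦X⟧} (p f r : A⟦X⟧) {d n : ℕ} (h : d < n) :
    coeff d (p * ((X * u) • f) ^ n * r) = 0 := by
  have : p * ((X * u) • f) ^ n * r = X ^ n * (p * (u • f) ^ n * r) := by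
    rw [mul_smul, series_X_smul, (commute_X _).symm.mul_pow, ← mul_assoc p,
      (commute_X_pow p n).eq]
    simp only [mul_assoc]
  rw [this, coeff_X_pow_mul', if_neg (by omega)]

/-- The coefficients of a geometric series. -/
theorem coeff_mul_geom {u : B⟦X⟧} {p g f r : A⟦X⟧} (h : g * (1 - (X * u) • f) = 1) (d : ℕ) :
    coeff d (p * g * r) = ∑ i ∈ range (d + 1), coeff d (p * ((X * u) • f) ^ i * r) := by
  conv_lhs => rw [eq_geom_sum_add h (d + 1)]
  rw [mul_add, add_mul, map_add, ← mul_assoc p, coeff_mul_X_smul_pow_mul _ _ _ (Nat.lt_succ_self d),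
    add_zero, mul_sum, sum_mul, map_sum]

theorem coeff_resolvent {u : B⟦X⟧} {x : A} {g : A⟦X⟧}
    (h : g * (1 - (X * u) • (C x : A⟦X⟧)) = 1) (d : ℕ) :
    coeff d g = ∑ i ∈ range (d + 1), coeff d ((X * u) ^ i) • x ^ i := by
  have := coeff_mul_geom (p := 1) (r := 1) h d
  rw [one_mul, mul_one] at this
  rw [this]
  refine sum_congr rfl fun i _ => ?_
  rw [one_mul, mul_one, smul_pow, ← map_pow, series_smul_C]

/-- The resolvent is ∑ (zu)^n x^n, so its expectation is the moment series at zu. -/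
theorem seriesExp_resolvent (E : A →ₗ[B] B) {u : B⟦X⟧} {x : A} {g : A⟦X⟧}
    (h : g * (1 - (X * u) • (C x : A⟦X⟧)) = 1) :
    seriesExp E g = (PowerSeries.mk fun n => E (x ^ n)).subst (X * u) := by
  ext d
  rw [coeff_seriesExp, coeff_resolvent h, coeff_subst_eq_sum (by simp) _ (Nat.lt_succ_self d),
    map_sum]
  exact sum_congr rfl fun i _ => by rw [map_smul, coeff_mk, smul_eq_mul, mul_comm]

theorem exists_inverse_one_sub (u : B⟦X⟧) (f : A⟦X⟧) :
    ∃ g : A⟦X⟧, g * (1 - (X * u) • f) = 1 ∧ (1 - (X * u) • f) * g = 1 := by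
  have h : constantCoeff (1 - (X * u) • f) = ((1 : Aˣ) : A) := by
    rw [mul_smul, series_X_smul, map_sub, map_one, map_mul, constantCoeff_X, zero_mul, sub_zero,
      Units.val_one]
  exact ⟨_, invOfUnit_mul _ 1 h, mul_invOfUnit _ 1 h⟩

/-- The algebraic identity behind the multiplicativity of the S-transform. -/
theorem resolvent_mul_eq_one {K R : Type*} [CommRing K] [Ring R] [Algebra K R] {z s t d : K}
    {a b c α β x y : R} (hz : ∀ p q : R, z • p = z • q → p = q) (hd : (1 + z) * d = 1)
    (hax : a * (1 - (z * s) • x) = 1)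
    (hyb : (1 - (z * t) • y) * b = 1) (hyb' : b * (1 - (z * t) • y) = 1)
    (ha : a = (1 + z) • (1 : R) + z • α) (hb : b = (1 + z) • (1 : R) + z • β)
    (hc : c * (1 - (z * d) • (α * β)) = 1) :
    (d • (b * c * a)) * (1 - (z * (s * t * (1 + z))) • (x * y)) = 1 := by
  have h1 : (z * s) • (a * x) = a - 1 := by
    rw [← hax]; simp [mul_sub]
  have h2 : (z * t) • (y * b) = b - 1 := by
    rw [← hyb]; simp [sub_mul]
  -- Times z, the left side is z a b - (1 + z) (a - 1) (b - 1). The factor 1 + z makes the terms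
  -- linear in α and in β cancel.
  have key : a * (1 - (z * (s * t * (1 + z))) • (x * y)) * b
      = (1 + z) • (1 - (z * d) • (α * β)) := by
    apply hz
    have e1 : z • (a * (1 - (z * (s * t * (1 + z))) • (x * y)) * b)
        = z • (a * b) - (1 + z) • (((z * s) • (a * x)) * ((z * t) • (y * b))) := by
      simp only [mul_sub, sub_mul, mul_one, smul_sub, mul_smul_comm, smul_mul_assoc, smul_smul,
        mul_assoc]
      congr 2
      ring
    have e2 : (1 + z) • (1 - (z * d) • (α * β)) = (1 + z) • (1 : R) - z • (α * β) := by
      rw [smul_sub, smul_smul]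
      congr 2
      linear_combination z * hd
    rw [e1, h1, h2, e2, ha, hb]
    simp only [mul_sub, sub_mul, mul_add, add_mul, mul_one, one_mul, smul_mul_assoc,
      mul_smul_comm]
    module
  set D := 1 - (z * (s * t * (1 + z))) • (x * y)
  calc (d • (b * c * a)) * D = d • (b * c * (a * D * b) * (1 - (z * t) • y)) := by
        rw [smul_mul_assoc, mul_assoc (b * c), mul_assoc (b * c), mul_assoc (a * D), hyb', mul_one]
    _ = ((1 + z) * d) • (b * (c * (1 - (z * d) • (α * β))) * (1 - (z * t) • y)) := by
        rw [key, mul_smul_comm, smul_mul_assoc, smul_smul, mul_comm d, mul_assoc b c]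
    _ = 1 := by rw [hd, hc, mul_one, hyb', one_smul]

end Series

/-! ### Multiplicativity of the S-transform -/

section Multiplicativity

open PowerSeries

variable {B A : Type*} [CommRing B] [Ring A] [Algebra B A]

/-- The moment series `∑_{n ≥ 0} E(x^n) z^n`. -/
noncomputable def momentSeries (E : A →ₗ[B] B) (x : A) : B⟦X⟧ :=
  PowerSeries.mk fun n => E (x ^ n)

/-- A resolvent splits into its expectation and a centred part. -/
theorem exists_resolvent_eq_add {E : A →ₗ[B] B} (hE : E 1 = 1) {S : Subalgebra B A} {x : A}
    (hx : x ∈ S) {s : B⟦X⟧} (hs : (momentSeries E x).subst (X * s) = 1 + X) :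
    ∃ a α : A⟦X⟧, a * (1 - (X * s) • (C x : A⟦X⟧)) = 1 ∧ (1 - (X * s) • (C x : A⟦X⟧)) * a = 1 ∧
      a = (1 + X : B⟦X⟧) • (1 : A⟦X⟧) + (X : B⟦X⟧) • α ∧ ∀ n, coeff n α ∈ centred E S := by
  obtain ⟨a, ha, ha'⟩ := exists_inverse_one_sub s (C x : A⟦X⟧)
  have hmem : ∀ n, coeff n a ∈ S := fun n => by
    rw [coeff_resolvent ha]
    exact S.sum_mem fun i _ => S.smul_mem (S.pow_mem hx i) _
  have hEa : seriesExp E a = 1 + X := (seriesExp_resolvent E ha).trans hs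
  set f : A⟦X⟧ := a - (1 + X : B⟦X⟧) • (1 : A⟦X⟧) with hf
  have hfmem : ∀ n, coeff n f ∈ centred E S := fun n => by
    have hc : coeff n ((1 + X : B⟦X⟧) • (1 : A⟦X⟧)) = coeff n (1 + X : B⟦X⟧) • (1 : A) := by
      rw [← map_one (C (R := A)), series_smul_C]
    refine ⟨?_, ?_⟩
    · change coeff n f ∈ S
      rw [hf, map_sub, hc]
      exact S.sub_mem (hmem n) (S.smul_mem S.one_mem _)
    · change E (coeff n f) = 0
      rw [← coeff_seriesExp, hf, map_sub, map_smul, hEa, seriesExp_one hE, smul_eq_mul, mul_one,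
        sub_self, map_zero]
  -- At z = 0 both `a` and 1 + z equal 1, so `f` is divisible by z; `α` is the quotient.
  have h0 : constantCoeff f = 0 := by
    rw [hf, map_sub, ← coeff_zero_eq_constantCoeff_apply, ← coeff_zero_eq_constantCoeff_apply,
      coeff_resolvent ha, ← map_one (C (R := A)), series_smul_C]
    simp
  obtain ⟨α, hα⟩ := X_dvd_iff.2 h0
  refine ⟨a, α, ha, ha', ?_, fun n => ?_⟩
  · rw [series_X_smul, ← hα, hf]
    abel
  · rw [← coeff_succ_X_mul n α, ← hα]
    exact hfmem _

theorem coeff_pow_mem_altSpan {E : A →ₗ[B] B} {S : Bool → Subalgebra B A} {c : Bool}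
    {f g : A⟦X⟧} (hf : ∀ n, coeff n f ∈ centred E (S c)) (hg : ∀ n, coeff n g ∈ centred E (S !c))
    (i n : ℕ) : coeff n ((f * g) ^ i) ∈ altSpan E S c (2 * i) := by
  induction i generalizing n with
  | zero =>
    rw [pow_zero, coeff_one]
    split_ifs
    · exact Submodule.one_le.1 le_rfl
    · exact Submodule.zero_mem _
  | succ i ih =>
    rw [pow_succ', mul_assoc]
    refine coeff_mul_mem hf (fun n => coeff_mul_mem hg (fun n => ?_) n) n
    simpa using ih n

/-- Expanding `b` and `a` leaves the words γ, βγ, γα, βγα with γ = (αβ)^i. All alternate, so only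
the empty word, γ at i = 0, survives. -/
theorem seriesExp_sandwich {E : A →ₗ[B] B} (hE : E 1 = 1) {S : Bool → Subalgebra B A}
    (hfree : IsAltFree E S) {a b α β : A⟦X⟧} {u v : B⟦X⟧} (ha : a = u • (1 : A⟦X⟧) + v • α)
    (hb : b = u • (1 : A⟦X⟧) + v • β) (hα : ∀ n, coeff n α ∈ centred E (S true))
    (hβ : ∀ n, coeff n β ∈ centred E (S false)) (i : ℕ) :
    seriesExp E (b * (α * β) ^ i * a) = if i = 0 then u * u else 0 := by
  set γ := (α * β) ^ i with hγ
  have hαβ := coeff_pow_mem_altSpan (c := true) hα hβ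
  have hβα := coeff_pow_mem_altSpan (c := false) hβ hα
  have zero : ∀ {c : Bool} {k : ℕ} {f : A⟦X⟧}, (∀ n, coeff n f ∈ altSpan E S c (k + 1)) →
      seriesExp E f = 0 := fun h => seriesExp_eq_zero fun n => hfree.eq_zero_of_mem (h n)
  have h1 : seriesExp E (β * γ) = 0 :=
    zero (c := false) (k := 2 * i) fun n => coeff_mul_mem hβ (hαβ i) n
  have h2 : seriesExp E (γ * α) = 0 := by
    rw [hγ, mul_pow_mul α β i]
    exact zero (c := true) (k := 2 * i) fun n => coeff_mul_mem hα (hβα i) n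
  have h3 : seriesExp E (β * (γ * α)) = 0 := by
    rw [hγ, mul_pow_mul α β i, ← mul_assoc, ← pow_succ']
    exact zero (c := false) (k := 2 * i + 1) fun n => hβα (i + 1) n
  have h4 : seriesExp E γ = if i = 0 then 1 else 0 := by
    split_ifs with hi
    · rw [hγ, hi, pow_zero, seriesExp_one hE]
    · obtain ⟨k, rfl⟩ := Nat.exists_eq_succ_of_ne_zero hi
      exact zero (c := true) (k := 2 * k + 1) fun n => hαβ (k + 1) n
  rw [ha, hb]
  simp only [add_mul, mul_add, smul_mul_assoc, mul_smul_comm, one_mul, mul_one, map_add, map_smul,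
    mul_assoc, h1, h2, h3, h4]
  simp

/-- For alternatingly free `x`, `y`, the inverse of the moment series of `x * y` in terms of those
of `x` and `y`. -/
theorem momentSeries_mul_subst {E : A →ₗ[B] B} (hE : E 1 = 1) {S : Bool → Subalgebra B A}
    (hfree : IsAltFree E S) {x y : A} (hx : x ∈ S true) (hy : y ∈ S false) {s t : B⟦X⟧}
    (hs : (momentSeries E x).subst (X * s) = 1 + X)
    (ht : (momentSeries E y).subst (X * t) = 1 + X) :
    (momentSeries E (x * y)).subst (X * (s * t * (1 + X))) = 1 + X := by
  obtain ⟨a, α, hax, -, ha, hα⟩ := exists_resolvent_eq_add hE hx hs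
  obtain ⟨b, β, hyb', hyb, hb, hβ⟩ := exists_resolvent_eq_add hE hy ht
  obtain ⟨d, hd⟩ : ∃ d : B⟦X⟧, (1 + X) * d = 1 :=
    ⟨_, mul_invOfUnit (1 + X : B⟦X⟧) 1 (by simp)⟩
  obtain ⟨c, hc, -⟩ := exists_inverse_one_sub d (α * β)
  have hr := resolvent_mul_eq_one (K := B⟦X⟧) (R := A⟦X⟧)
    (fun p q h => X_mul_cancel (by simpa only [series_X_smul] using h)) hd hax hyb hyb' ha hb hc
  rw [← map_mul] at hr
  refine (seriesExp_resolvent E hr).symm.trans ?_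
  have hbca : seriesExp E (b * c * a) = (1 + X) * (1 + X) := by
    ext n
    rw [coeff_seriesExp, coeff_mul_geom hc, map_sum, sum_eq_single 0]
    · rw [pow_zero, ← coeff_seriesExp, ← pow_zero (α * β), seriesExp_sandwich hE hfree ha hb hα hβ,
        if_pos rfl]
    · intro i _ hi
      rw [← coeff_seriesExp, smul_pow, mul_smul_comm, smul_mul_assoc, map_smul,
        seriesExp_sandwich hE hfree ha hb hα hβ, if_neg hi, smul_zero, map_zero]
    · simp
  rw [map_smul, hbca, smul_eq_mul]
  linear_combination (1 + X) * hd

end Multiplicativity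

/-! ### From moment series to the S-transform over D_N. -/

section STransform

open PowerSeries

theorem one_subst {R : Type*} [CommRing R] {u : R⟦X⟧} (hu : HasSubst u) :
    (1 : R⟦X⟧).subst u = 1 := by
  rw [← coe_substAlgHom hu, map_one]

/-- The moment series determines an inverse of the moment. -/
theorem mul_constantCoeff_eq_one {B A : Type*} [CommRing B] [Ring A] [Algebra B A] {E : A →ₗ[B] B}
    {x : A} {s : B⟦X⟧} (hs : (momentSeries E x).subst (X * s) = 1 + X) :
    E x * constantCoeff s = 1 := by
  -- The coefficient of z on the left is E(x) s(0).
  have h := congrArg (coeff 1) hs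
  rw [coeff_subst_eq_sum (by simp) _ (Nat.lt_succ_self 1), sum_range_succ, sum_range_one] at h
  simpa [coeff_one, momentSeries, coeff_succ_X_mul 0] using h

/-- M - 1 has no constant term and linear coefficient E(x), a unit, so it has a compositional
inverse, which is divisible by z. -/
theorem exists_momentSeries_subst {B A : Type*} [CommRing B] [Ring A] [Algebra B A]
    {E : A →ₗ[B] B} (hE : E 1 = 1) {x : A} (hx : IsUnit (E x)) :
    ∃ s : B⟦X⟧, (momentSeries E x).subst (X * s) = 1 + X := by
  set ψ := momentSeries E x - 1 with hψ
  have h0 : constantCoeff ψ = 0 := by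
    rw [hψ, map_sub, ← coeff_zero_eq_constantCoeff_apply]
    simp [momentSeries, hE]
  have h1 : IsUnit (coeff 1 ψ) := by
    rw [hψ]
    simpa [momentSeries, coeff_one] using hx
  obtain ⟨s, hs⟩ := X_dvd_iff.2 (constantCoeff_substInvOfIsUnit ψ h1)
  refine ⟨s, ?_⟩
  have hsub : HasSubst (X * s) := HasSubst.of_constantCoeff_zero' (by simp)
  have hM : momentSeries E x = 1 + ψ := by rw [hψ]; abel
  rw [hM, subst_add hsub, one_subst hsub, ← hs, subst_substInvOfIsUnit_right ψ h0 h1]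

variable {N : ℕ} {A : Fin N → Type*} [∀ j, Ring (A j)] [∀ j, Algebra ℂ (A j)]

/-- The map `E` as a `D_N`-linear map. -/
def condExpDiag (φ : ∀ j, A j →ₗ[ℂ] ℂ) : (∀ j, A j) →ₗ[Diag N] Diag N where
  toFun := condExp φ
  map_add' := map_add _
  map_smul' d a := by
    ext j
    simp [condExp]

theorem condExpDiag_one {φ : ∀ j, A j →ₗ[ℂ] ℂ} (hφ : ∀ j, φ j 1 = 1) :
    condExpDiag φ 1 = 1 := by
  ext j
  simp [condExpDiag, condExp, hφ]

theorem Diag.mem_inv_iff_isUnit {d : Diag N} : d ∈ Diag.inv N ↔ IsUnit d := by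
  simp [Diag.inv, Pi.isUnit_iff]

theorem momentSeries_eq_subst_rTransform {φ : ∀ j, A j →ₗ[ℂ] ℂ} (hφ : ∀ j, φ j 1 = 1)
    (x : ∀ j, A j) :
    momentSeries (condExpDiag φ) x
      = 1 + (rTransform φ x).subst (X * momentSeries (condExpDiag φ) x) := by
  refine mk_moment_eq_subst (k := fun n => cumulant φ fun _ : Fin n => x) fun S => ?_
  have := ncSum_cumulant φ hφ (fun _ : ℕ => x) S
  rw [this, setMoment, List.map_const', List.prod_replicate, length_sort]
  rfl

/-- The S-transform in terms of the inverse of the moment series. -/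
theorem sTransform_eq {φ : ∀ j, A j →ₗ[ℂ] ℂ} (hφ : ∀ j, φ j 1 = 1) {x : ∀ j, A j}
    (hx : condExp φ x ∈ Diag.inv N) {s : (Diag N)⟦X⟧}
    (hs : (momentSeries (condExpDiag φ) x).subst (X * s) = 1 + X) :
    sTransform φ x hx = s * (1 + X) := by
  set M := momentSeries (condExpDiag φ) x
  set w := X * (s * (1 + X))
  have hsub : HasSubst (X * s) := HasSubst.of_constantCoeff_zero' (by simp)
  have hw : HasSubst w := HasSubst.of_constantCoeff_zero' (by simp [w])
  have hXM : HasSubst (X * M) := HasSubst.of_constantCoeff_zero' (by simp)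
  have hR : HasSubst (rTransform φ x) :=
    HasSubst.of_constantCoeff_zero' (by simp [rTransform])
  -- Substitute zs for z in M = 1 + R(zM); since M(zs) = 1 + z, the argument zM becomes `w`.
  have h1 : (rTransform φ x).subst w = X := by
    have h := hs
    rw [show M = 1 + (rTransform φ x).subst (X * M) from momentSeries_eq_subst_rTransform hφ x,
      subst_add hsub, one_subst hsub, subst_comp_subst_apply hXM hsub, subst_mul hsub,
      subst_X hsub, hs, mul_assoc] at h
    exact add_left_cancel h
  refine X_mul_cancel ?_
  -- A left and a right compositional inverse of R agree.
  have h2 := subst_comp_subst_apply hR hw (X * sTransform φ x hx)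
  rw [(X_mul_sTransform φ x hx).2, h1, subst_X hw, X_subst] at h2
  exact h2.symm

/-- The resolvent argument is D_N-linear, whereas freeness is stated for complex subalgebras
containing D_N. -/
theorem mem_adjoin_of_mem_adjoin_diag {x a : ∀ j, A j} (ha : a ∈ Algebra.adjoin (Diag N) {x}) :
    a ∈ Algebra.adjoin ℂ ({x} ∪ diagSet A) := by
  induction ha using Algebra.adjoin_induction with
  | mem a ha => exact Algebra.subset_adjoin (Or.inl ha)
  | algebraMap d => exact Algebra.subset_adjoin (Or.inr ⟨d, rfl⟩)
  | add a b _ _ ha hb => exact add_mem ha hb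
  | mul a b _ _ ha hb => exact mul_mem ha hb

theorem FreeOverDiag.isAltFree {φ : ∀ j, A j →ₗ[ℂ] ℂ} (hφ : ∀ j, φ j 1 = 1) {x y : ∀ j, A j}
    (h : FreeOverDiag φ x y) :
    IsAltFree (condExpDiag φ) fun c => Algebra.adjoin (Diag N) {if c then x else y} := by
  intro c n a ha h0
  refine FreeSubalgebras.condExp_prod_eq_zero hφ h (Nat.succ_ne_zero n)
    (c := fun i => altColor c i) ?_ ?_ ?_ h0
  · intro i k hik
    rw [← hik, altColor, altColor, Nat.bodd_succ]
    cases c <;> cases (i : ℕ).bodd <;> simp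
  · intro i hi
    have := ha i
    rw [hi] at this
    exact mem_adjoin_of_mem_adjoin_diag this
  · intro i hi
    have := ha i
    rw [hi] at this
    exact mem_adjoin_of_mem_adjoin_diag this

end STransform

end DirectProductFreeProb

open DirectProductFreeProb in
theorem mainTheorem3 {N : ℕ} {A : Fin N → Type*} [∀ j, Ring (A j)] [∀ j, Algebra ℂ (A j)]
    (φ : ∀ j, A j →ₗ[ℂ] ℂ) (hφ : ∀ j, φ j 1 = 1) (x y : ∀ j, A j)
    (hx : condExp φ x ∈ Diag.inv N) (hy : condExp φ y ∈ Diag.inv N)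
    (hfree : FreeOverDiag φ x y) :
    ∃ hxy : condExp φ (x * y) ∈ Diag.inv N,
      sTransform φ x hx ∈ invSeries N ∧ sTransform φ y hy ∈ invSeries N ∧
      sTransform φ (x * y) hxy ∈ invSeries N ∧
      sTransform φ (x * y) hxy = sTransform φ x hx * sTransform φ y hy := by
  have hE := condExpDiag_one hφ
  obtain ⟨s, hs⟩ := exists_momentSeries_subst hE (x := x) (Diag.mem_inv_iff_isUnit.1 hx)
  obtain ⟨t, ht⟩ := exists_momentSeries_subst hE (x := y) (Diag.mem_inv_iff_isUnit.1 hy)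
  have hst := momentSeries_mul_subst hE (hfree.isAltFree hφ)
    (Algebra.subset_adjoin (by simp)) (Algebra.subset_adjoin (by simp)) hs ht
  -- Invertibility of E(xy) is read off the linear coefficient of `hst`.
  have hxy : condExp φ (x * y) ∈ Diag.inv N :=
    Diag.mem_inv_iff_isUnit.2 (IsUnit.of_mul_eq_one _ (mul_constantCoeff_eq_one hst))
  have key : ∀ {z : ∀ j, A j} (hz : condExp φ z ∈ Diag.inv N) {r : PowerSeries (Diag N)},
      (momentSeries (condExpDiag φ) z).subst (PowerSeries.X * r) = 1 + PowerSeries.X →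
      sTransform φ z hz ∈ invSeries N := by
    intro z hz r hr
    have h : PowerSeries.constantCoeff (sTransform φ z hz) = PowerSeries.constantCoeff r := by
      rw [sTransform_eq hφ hz hr]
      simp
    change PowerSeries.constantCoeff (sTransform φ z hz) ∈ Diag.inv N
    rw [h]
    exact Diag.mem_inv_iff_isUnit.2
      (IsUnit.of_mul_eq_one _ ((mul_comm _ _).trans (mul_constantCoeff_eq_one hr)))
  refine ⟨hxy, key hx hs, key hy ht, key hxy hst, ?_⟩
  rw [sTransform_eq hφ hx hs, sTransform_eq hφ hy ht, sTransform_eq hφ hxy hst]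
  ring
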